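/- Let $\|A\|_p=(\sum_i\sigma_i(A)^p)^{1/p}$ denote the Schatten-$p$ norm of a real square matrix $A$ with singular values $\sigma_i(A)$. For every $\delta_0<1$ there is a constant $c>0$, depending only on $\delta_0$, such that the following holds. Let $p\in[1,2]$, $0<\delta\le\delta_0$ and $0<\varepsilon<(\log(1/\delta))^{1/2-1/p}$, and if $p=1$ assume also $\varepsilon<1$. Then, for all sufficiently large $n$ (depending on $p,\delta,\varepsilon$), every randomized algorithm that accesses an unknown matrix $A\in\mathbb R^{n\times n}$ only through $m$ adaptively chosen matrix-vector products $v\mapsto Av$ with $v\in\mathbb R^n$, and that, for every $A\in\mathbb R^{n\times n}$, outputs a number $t$ with $$\Pr\big[\,|t-\mathrm{tr}(A)|\le\varepsilon\|A\|_p\,\big]\ge 1-\delta ,$$ must use $$m\ \ge\ c\left(\frac{\sqrt{\log(1/\delta)}}{\varepsilon}\right)^{p}$$ queries. Here a query vector may be any (jointly Borel measurable) function of the random seed and of the previous answers, and the output any such function of the random seed and of all answers. In particular, an algorithm with this guarantee for square matrices of every size, making at most $m$ queries on every input, satisfies this bound. -/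

import Mathlib

open MeasureTheory

/-- The Schatten `p`-norm `(∑ i, σ i ^ p) ^ (1 / p)` of a real `n × n` matrix, where
`σ 0 ≥ … ≥ σ (n - 1)` are its singular values with respect to the Euclidean norm. -/
noncomputable def schattenNorm (p : ℝ) {n : ℕ} (A : Matrix (Fin n) (Fin n) ℝ) : ℝ :=
  (∑ i ∈ Finset.range n, (Matrix.toEuclideanLin A).singularValues i ^ p) ^ (1 / p)

/-- A randomized adaptive algorithm that makes `m` real-valued matrix-vector multiplication queries
to an unknown `n × n` matrix and then outputs a real number. Its random seed is a point of `Ω`.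
Each query vector is an arbitrary jointly measurable function of the seed and of the answers to the
earlier queries (the earlier query vectors are themselves functions of these data), and so is the
output. An algorithm that stops early is included: its remaining queries can be the zero vector. -/
structure QueryAlgorithm (Ω : Type*) [MeasurableSpace Ω] (n m : ℕ) where
  /-- The query vector with index `k`, given the seed and the `k` answers received so far. -/
  query : (k : Fin m) → Ω → (Fin k → Fin n → ℝ) → Fin n → ℝ
  measurable_query : ∀ k, Measurable (Function.uncurry (query k))
  /-- The output, given the seed and all `m` answers. -/
  output : Ω → (Fin m → Fin n → ℝ) → ℝ
  measurable_output : Measurable (Function.uncurry output)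

namespace QueryAlgorithm

variable {Ω : Type*} [MeasurableSpace Ω] {n m : ℕ}

/-- The first `k` answers `A *ᵥ v₀, …, A *ᵥ vₖ₋₁` that the algorithm receives when it is run on the
matrix `A` with seed `ω`. -/
def answers (alg : QueryAlgorithm Ω n m) (A : Matrix (Fin n) (Fin n) ℝ) (ω : Ω) :
    (k : ℕ) → k ≤ m → Fin k → Fin n → ℝ
  | 0, _ => Fin.elim0
  | k + 1, hk =>
      Fin.snoc (α := fun _ => Fin n → ℝ) (answers alg A ω k (Nat.le_of_succ_le hk))
        (A.mulVec (alg.query ⟨k, hk⟩ ω (answers alg A ω k (Nat.le_of_succ_le hk))))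

/-- The output of the algorithm when it is run on the matrix `A` with seed `ω`. -/
def run (alg : QueryAlgorithm Ω n m) (A : Matrix (Fin n) (Fin n) ℝ) (ω : Ω) : ℝ :=
  alg.output ω (alg.answers A ω m le_rfl)

/-- With the seed distributed according to `μ`, on every input matrix `A` the algorithm outputs,
with probability at least `1 - δ`, a number `t` with `|t - tr A| ≤ ε * ‖A‖_p`. -/
def EstimatesTrace (alg : QueryAlgorithm Ω n m) (μ : Measure Ω) (p ε δ : ℝ) : Prop :=
  ∀ A : Matrix (Fin n) (Fin n) ℝ,
    1 - δ ≤ μ.real {ω | |alg.run A ω - A.trace| ≤ ε * schattenNorm p A}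

end QueryAlgorithm

/-!
The hard input is `A = E * G * Eᵀ`, where `G` is an `r × r` matrix of independent standard Gaussians,
`E` is an isometric embedding `ℝ^r → ℝ^n`, and `r` is a small multiple of
`k = (√(log (1 / δ)) / ε) ^ p`. The trace of `G` is a Gaussian of variance `r`. Queries reveal `G` on
the span of the queried vectors only; by rotation invariance, whatever the adaptive choices, after
`m` queries the trace still contains an independent Gaussian of variance `r - m`. If `m ≤ r / 2`, the
best prediction of `tr A` therefore misses by more than a small multiple of `√(r * log (1 / δ))` with
probability noticeably larger than `δ`. On the other hand the Frobenius norm of `G` is of order `r`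
with overwhelming probability, so by the power mean inequality `‖A‖_p` is of order
`r ^ (1 / p + 1 / 2)`, and the choice of `r` makes `ε * ‖A‖_p` smaller than that error. The hypothesis
on `ε` says that `k > log (1 / δ)`, which bounds the exceptional probability `exp (-r²)` of the
Frobenius estimate by `δ`.

The information-theoretic part is `gaussianMatrix_abs_output_sub_le`. It is an induction on the number
of queries that removes the *first* query: for a fixed seed this is a constant vector, so the columns
of `G` can be rotated to make it a multiple of the first basis vector, and conditionally on the first
column the remaining rounds form an algorithm for the other columns. No measurable choice of
orthonormal bases is involved. `QueryAlgorithm.mul_gaussianMatrix_le` averages over seed and matrix,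
and `QueryAlgorithm.one_sub_mul_le` adds the norm bounds `schattenNorm_sq_le` and
`gaussianMatrix_sum_sq_ge_le`. `exists_gaussianReal_abs_sub_le` supplies the lower bound on the
unpredictability of a Gaussian, with constants that depend on `δ₀` only.

When `k` is bounded in terms of `δ₀`, the claim only says that at least one query is made, which is
`QueryAlgorithm.ne_zero_of_estimatesTrace`; this is where `ε < 1` for `p = 1`, and large `n` for
`p > 1`, are used.
-/

open ProbabilityTheory Matrix

/-! ### Gaussian vectors and matrices -/

/-- The law of a matrix with `r` rows and `d` columns whose entries are independent standard
Gaussians. Matrices are encoded as families of rows, which carry the product σ-algebra. -/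
noncomputable def gaussianMatrix (r d : ℕ) : Measure (Fin r → Fin d → ℝ) :=
  Measure.pi fun _ => Measure.pi fun _ => gaussianReal 0 1

instance isProbabilityMeasure_gaussianMatrix (r d : ℕ) :
    IsProbabilityMeasure (gaussianMatrix r d) := by
  unfold gaussianMatrix; infer_instance

lemma map_sum_pi_gaussianReal (n : ℕ) (v : Fin n → NNReal) :
    (Measure.pi fun i => gaussianReal 0 (v i)).map (fun z => ∑ i, z i) =
      gaussianReal 0 (∑ i, v i) := by
  induction n with
  | zero => simp [gaussianReal_zero_var, Measure.map_const]
  | succ n ih =>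
    have h := measurePreserving_piFinSuccAbove (fun i => gaussianReal 0 (v i)) 0
    have e : (fun z : Fin (n + 1) → ℝ => ∑ i, z i) =
        (fun a : ℝ × ℝ => a.1 + a.2) ∘ (Prod.map id fun z : Fin n → ℝ => ∑ i, z i) ∘
          MeasurableEquiv.piFinSuccAbove (fun _ => ℝ) 0 := by
      funext z
      simp [Fin.sum_univ_succ, MeasurableEquiv.piFinSuccAbove, Fin.tail]
    have hm : Measurable fun z : Fin n → ℝ => ∑ i, z i := by fun_prop
    rw [e, ← Measure.map_map (by fun_prop) (by fun_prop), ← Measure.map_map (by fun_prop)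
      (by fun_prop), h.map_eq, ← Measure.map_prod_map _ _ measurable_id hm, Measure.map_id]
    have := ih (fun i => v i.succ)
    simp only [Fin.zero_succAbove]
    rw [this, Fin.sum_univ_succ]
    have h2 := gaussianReal_conv_gaussianReal (m₁ := 0) (m₂ := 0) (v₁ := v 0)
      (v₂ := ∑ i : Fin n, v i.succ)
    simpa [Measure.conv] using h2

lemma map_dotProduct_pi_gaussianReal {n : ℕ} (w : Fin n → ℝ) :
    (Measure.pi fun _ : Fin n => gaussianReal 0 1).map (fun z => w ⬝ᵥ z) =
      gaussianReal 0 (∑ i, (w i ^ 2).toNNReal) := by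
  rw [← map_sum_pi_gaussianReal]
  have h : MeasurePreserving (fun (z : Fin n → ℝ) i => w i * z i)
      (Measure.pi fun _ : Fin n => gaussianReal 0 1)
      (Measure.pi fun i => gaussianReal 0 ((w i ^ 2).toNNReal)) := by
    refine measurePreserving_pi _ _ fun i => ⟨by fun_prop, ?_⟩
    rw [gaussianReal_map_const_mul, mul_zero, mul_one]
    congr 1
    ext
    simp [sq_nonneg]
  rw [← h.map_eq, Measure.map_map (by fun_prop) h.measurable]
  rfl

lemma map_sum_dotProduct_gaussianMatrix {r d : ℕ} (B : Fin r → Fin d → ℝ) :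
    (gaussianMatrix r d).map (fun G => ∑ i, B i ⬝ᵥ G i) =
      gaussianReal 0 (∑ i, ∑ a, (B i a ^ 2).toNNReal) := by
  rw [← map_sum_pi_gaussianReal]
  have hm : ∀ w : Fin d → ℝ, Measurable fun z => w ⬝ᵥ z := fun w => by
    unfold dotProduct; fun_prop
  have h : MeasurePreserving (fun (G : Fin r → Fin d → ℝ) i => B i ⬝ᵥ G i)
      (gaussianMatrix r d)
      (Measure.pi fun i => gaussianReal 0 (∑ a, (B i a ^ 2).toNNReal)) :=
    measurePreserving_pi _ _ fun i => ⟨hm _, map_dotProduct_pi_gaussianReal _⟩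
  rw [← h.map_eq, Measure.map_map (by fun_prop) h.measurable]
  rfl

/-- Rotation invariance of the standard Gaussian vector. -/
lemma measurePreserving_vecMul_pi_gaussianReal {d : ℕ} (Q : Matrix (Fin d) (Fin d) ℝ)
    (b : OrthonormalBasis (Fin d) ℝ (EuclideanSpace ℝ (Fin d))) (hQ : ∀ k a, Q k a = b k a) :
    MeasurePreserving (fun z : Fin d → ℝ => z ᵥ* Q)
      (Measure.pi fun _ => gaussianReal 0 1) (Measure.pi fun _ => gaussianReal 0 1) := by
  have hm : Measurable fun z : Fin d → ℝ => z ᵥ* Q := by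
    unfold vecMul dotProduct; fun_prop
  refine ⟨hm, ?_⟩
  have h1 := stdGaussian_eq_map_pi_orthonormalBasis b
  have h2 := map_pi_eq_stdGaussian (ι := Fin d)
  rw [h1] at h2
  have h3 := congrArg (Measure.map (WithLp.ofLp (p := 2))) h2
  rw [Measure.map_map (by fun_prop) (by fun_prop), Measure.map_map (by fun_prop) (by fun_prop)] at h3
  have e1 : (WithLp.ofLp ∘ WithLp.toLp 2 : (Fin d → ℝ) → _) = id := rfl
  rw [e1, Measure.map_id] at h3
  conv_rhs => rw [h3]
  congr 1
  funext z a
  simp [vecMul, dotProduct, hQ]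

/-- Every vector is a multiple of the first vector of some orthonormal basis. -/
lemma exists_orthonormalBasis_smul_zero {d : ℕ} (v : EuclideanSpace ℝ (Fin (d + 1))) :
    ∃ b : OrthonormalBasis (Fin (d + 1)) ℝ (EuclideanSpace ℝ (Fin (d + 1))),
      v = ‖v‖ • b 0 := by
  by_cases hv : v = 0
  · exact ⟨EuclideanSpace.basisFun _ ℝ, by simp [hv]⟩
  have hn : ‖v‖ ≠ 0 := norm_ne_zero_iff.2 hv
  obtain ⟨b, hb⟩ := Orthonormal.exists_orthonormalBasis_extension_of_card_eq (𝕜 := ℝ)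
    (ι := Fin (d + 1)) (E := EuclideanSpace ℝ (Fin (d + 1))) (by simp)
    (v := fun _ => ‖v‖⁻¹ • v) (s := {0}) (by
      refine ⟨fun i => ?_, fun i j hij => (hij (Subsingleton.elim _ _)).elim⟩
      simp [Set.domRestrict, norm_smul, hn])
  refine ⟨b, ?_⟩
  rw [hb 0 rfl, smul_smul, mul_inv_cancel₀ hn, one_smul]

/-- Every vector is turned by an orthogonal matrix into a multiple of the first standard basis
vector. -/
lemma exists_orthogonal_mulVec_eq_single {d : ℕ} (v : Fin (d + 1) → ℝ) :
    ∃ (Q : Matrix (Fin (d + 1)) (Fin (d + 1)) ℝ) (c : ℝ), Q * Qᵀ = 1 ∧ Q *ᵥ v = Pi.single 0 c ∧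
      MeasurePreserving (fun z : Fin (d + 1) → ℝ => z ᵥ* Q)
        (Measure.pi fun _ => gaussianReal 0 1) (Measure.pi fun _ => gaussianReal 0 1) := by
  obtain ⟨b, hb⟩ := exists_orthonormalBasis_smul_zero (WithLp.toLp 2 v)
  have ho : ∀ k l, ∑ a, b k a * b l a = if k = l then 1 else 0 := fun k l => by
    have := orthonormal_iff_ite.1 b.orthonormal l k
    simp only [PiLp.inner_apply, RCLike.inner_apply, conj_trivial] at this
    rw [this]; simp [eq_comm]
  refine ⟨Matrix.of fun k a => b k a, ‖WithLp.toLp 2 v‖, ?_, ?_,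
    measurePreserving_vecMul_pi_gaussianReal _ b fun _ _ => rfl⟩
  · ext k l
    simp [Matrix.mul_apply, ho, Matrix.one_apply]
  · funext k
    have hv : ∀ a, v a = ‖WithLp.toLp 2 v‖ * b 0 a := fun a => by
      have := congrArg (fun x : EuclideanSpace ℝ (Fin (d + 1)) => x a) hb
      simpa using this
    simp only [mulVec, dotProduct, Matrix.of_apply]
    calc ∑ a, b k a * v a = ‖WithLp.toLp 2 v‖ * ∑ a, b k a * b 0 a := by
          rw [Finset.mul_sum]
          refine Finset.sum_congr rfl fun a _ => ?_
          rw [hv a]; ring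
      _ = _ := by rw [ho]; by_cases h : k = 0 <;> simp [h]

/-- The matrix with first column `y` and remaining columns `G`. -/
def consColumn {r d : ℕ} (y : Fin r → ℝ) (G : Fin r → Fin d → ℝ) : Fin r → Fin (d + 1) → ℝ :=
  fun i => Fin.cons (y i) (G i)

/-- A Gaussian matrix is a Gaussian column followed by an independent Gaussian matrix. -/
lemma measurePreserving_consColumn (r d : ℕ) :
    MeasurePreserving (fun p : (Fin r → ℝ) × (Fin r → Fin d → ℝ) => consColumn p.1 p.2)
      ((Measure.pi fun _ => gaussianReal 0 1).prod (gaussianMatrix r d))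
      (gaussianMatrix r (d + 1)) := by
  have h1 := (measurePreserving_arrowProdEquivProdArrow ℝ (Fin d → ℝ) (Fin r)
    (fun _ => gaussianReal 0 1) (fun _ => Measure.pi fun _ => gaussianReal 0 1)).symm
  have h2 := measurePreserving_pi
    (fun _ : Fin r => (gaussianReal 0 1).prod (Measure.pi fun _ : Fin d => gaussianReal 0 1))
    (fun _ : Fin r => Measure.pi fun _ : Fin (d + 1) => gaussianReal 0 1)
    (fun _ => (measurePreserving_piFinSuccAbove (fun _ : Fin (d + 1) => gaussianReal 0 1) 0).symm)
  convert! h2.comp h1 using 1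
  funext p i a
  refine Fin.cases ?_ (fun a => ?_) a <;>
    simp [consColumn, MeasurableEquiv.piFinSuccAbove, MeasurableEquiv.arrowProdEquivProdArrow,
      Equiv.arrowProdEquivProdArrow]

/-! ### Adaptive queries to a Gaussian matrix -/

lemma measurable_mulVec {k l : ℕ} (E : Matrix (Fin k) (Fin l) ℝ) :
    Measurable fun v : Fin l → ℝ => E *ᵥ v := by
  refine measurable_pi_lambda _ fun a => ?_
  simp only [mulVec, dotProduct]
  fun_prop

/-- One round of an adaptive algorithm with state space `S`: in the state `s` it queries the vector
`q s`, and after receiving the answer `y` it passes to the state `u (s, y)`. -/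
def queryStep {S : Type*} {r d : ℕ} (q : S → Fin d → ℝ) (u : S × (Fin r → ℝ) → S)
    (G : Fin r → Fin d → ℝ) (s : S) : S :=
  u (s, fun i => G i ⬝ᵥ q s)

/-- Joint measurability in the unknown matrix and the initial state, as needed for Fubini's
theorem. -/
lemma measurable_iterate_queryStep {S : Type*} [MeasurableSpace S] {r d : ℕ}
    {q : S → Fin d → ℝ} (hq : Measurable q) {u : S × (Fin r → ℝ) → S} (hu : Measurable u) (j : ℕ) :
    Measurable fun p : (Fin r → Fin d → ℝ) × S => (queryStep q u p.1)^[j] p.2 := by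
  induction j with
  | zero => exact measurable_snd
  | succ j ih =>
    have h : Measurable fun p : (Fin r → Fin d → ℝ) × S => queryStep q u p.1 p.2 := by
      unfold queryStep dotProduct
      fun_prop
    simp only [Function.iterate_succ_apply]
    exact ih.comp (measurable_fst.prodMk h)

lemma measurableSet_abs_sub_le {α : Type*} [MeasurableSpace α] {f g : α → ℝ} (hf : Measurable f)
    (hg : Measurable g) (x : ℝ) : MeasurableSet {a | |f a - g a| ≤ x} :=
  measurableSet_le (hf.sub hg).abs measurable_const

/-- Adaptive matrix-vector queries do not help to predict a functional `G ↦ ∑ i, ⟨B i, G i⟩` of a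
Gaussian matrix `G`, if `B` has orthonormal columns: after `j` queries this functional still
contains an independent Gaussian whose variance is the number of columns minus `j`. -/
theorem gaussianMatrix_abs_output_sub_le {S : Type*} [MeasurableSpace S] {r : ℕ} {x : ℝ}
    {β : ENNReal} {d' : ℕ} (hβ : ∀ t : ℝ, gaussianReal 0 d' {z | |t - z| ≤ x} ≤ β) (j : ℕ)
    {d : ℕ} (hd : d = d' + j) (B : Fin r → Fin d → ℝ) (hB : (Matrix.of B)ᵀ * Matrix.of B = 1)
    (q : S → Fin d → ℝ) (hq : Measurable q) (u : S × (Fin r → ℝ) → S) (hu : Measurable u)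
    (out : S → ℝ) (hout : Measurable out) (s₀ : S) :
    gaussianMatrix r d
      {G | |out ((queryStep q u G)^[j] s₀) - ∑ i, B i ⬝ᵥ G i| ≤ x} ≤ β := by
  induction j generalizing d s₀ u out with
  | zero =>
    subst hd
    have hv : ∑ i, ∑ a, (B i a ^ 2).toNNReal = (d : NNReal) := by
      rw [Finset.sum_comm]
      have : ∀ a, ∑ i, (B i a ^ 2).toNNReal = 1 := fun a => by
        rw [← Real.toNNReal_sum_of_nonneg fun _ _ => sq_nonneg _]
        have h := congrFun (congrFun hB a) a
        rw [Matrix.mul_apply, Matrix.one_apply_eq] at h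
        simp only [Matrix.transpose_apply, Matrix.of_apply, ← sq] at h
        rw [h, Real.toNNReal_one]
      simp [this]
    have h := map_sum_dotProduct_gaussianMatrix B
    have hm : Measurable fun G : Fin r → Fin d → ℝ => ∑ i, B i ⬝ᵥ G i := by
      unfold dotProduct; fun_prop
    have h2 := hβ (out s₀)
    rw [hv] at h
    rw [← h, Measure.map_apply hm
      (measurableSet_le (by fun_prop) measurable_const)] at h2
    exact h2
  | succ j ih =>
    obtain rfl : d = d' + j + 1 := hd
    obtain ⟨Q, c, hQ, hQv, hmp⟩ := exists_orthogonal_mulVec_eq_single (q s₀)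
    -- Rotate the columns of `G` so that the first query reads off a multiple of the first column.
    have hrot : MeasurePreserving (fun (G : Fin r → Fin (d' + j + 1) → ℝ) i => G i ᵥ* Q)
        (gaussianMatrix r (d' + j + 1)) (gaussianMatrix r (d' + j + 1)) :=
      measurePreserving_pi _ _ fun _ => hmp
    have hcomp := hrot.comp (measurePreserving_consColumn r (d' + j))
    have hqQ : Measurable fun s => Q *ᵥ q s := (measurable_mulVec Q).comp hq
    let B' : Fin r → Fin (d' + j + 1) → ℝ := fun i => Q *ᵥ B i
    have hB' : (Matrix.of B')ᵀ * Matrix.of B' = 1 := by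
      have : Matrix.of B' = Matrix.of B * Qᵀ := by
        ext i a
        simp [B', Matrix.mul_apply, mulVec, dotProduct, mul_comm]
      simp only [this, Matrix.transpose_mul, Matrix.transpose_transpose]
      rw [Matrix.mul_assoc, ← Matrix.mul_assoc _ _ Qᵀ, hB, Matrix.one_mul, hQ]
    let B'' : Fin r → Fin (d' + j) → ℝ := fun i a => B' i a.succ
    have hB'' : (Matrix.of B'')ᵀ * Matrix.of B'' = 1 := by
      ext a b
      have h := congrFun (congrFun hB' a.succ) b.succ
      rw [Matrix.mul_apply] at h ⊢
      rw [Matrix.one_apply] at h ⊢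
      simpa [B''] using h
    have hset : MeasurableSet {G : Fin r → Fin (d' + j + 1) → ℝ |
        |out ((queryStep q u G)^[j + 1] s₀) - ∑ i, B i ⬝ᵥ G i| ≤ x} := by
      refine measurableSet_abs_sub_le ?_ (by unfold dotProduct; fun_prop) _
      exact hout.comp ((measurable_iterate_queryStep hq hu (j + 1)).comp
        (measurable_id.prodMk measurable_const))
    rw [← hcomp.map_eq, Measure.map_apply hcomp.measurable hset,
      Measure.prod_apply (hcomp.measurable hset)]
    refine (lintegral_mono fun y => ?_).trans (lintegral_const β).le |>.trans (by simp)
    -- Given the first column `y`, the remaining rounds query only the other columns.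
    let u' : S × (Fin r → ℝ) → S := fun p => u (p.1, p.2 + (Q *ᵥ q p.1) 0 • y)
    have hu' : Measurable u' := by
      refine hu.comp (measurable_fst.prodMk ?_)
      refine measurable_snd.add ?_
      exact ((measurable_pi_apply 0).comp (hqQ.comp measurable_fst)).smul measurable_const
    have hdot : ∀ (G : Fin r → Fin (d' + j) → ℝ) (w : Fin (d' + j + 1) → ℝ) (i : Fin r),
        (consColumn y G i ᵥ* Q) ⬝ᵥ w = G i ⬝ᵥ (fun a => (Q *ᵥ w) a.succ) + (Q *ᵥ w) 0 * y i := by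
      intro G w i
      rw [← Matrix.dotProduct_mulVec, dotProduct, Fin.sum_univ_succ]
      simp [consColumn, dotProduct]
      ring
    have hstep : ∀ G, queryStep q u (fun i => consColumn y G i ᵥ* Q) =
        queryStep (fun s a => (Q *ᵥ q s) a.succ) u' G := by
      intro G
      funext s
      simp only [queryStep, u', hdot]
      rfl
    have hfirst : ∀ G, queryStep q u (fun i => consColumn y G i ᵥ* Q) s₀ = u (s₀, c • y) := by
      intro G
      simp only [queryStep, hdot, hQv]
      congr 2
      funext i
      simp [dotProduct]
    have htarget : ∀ G : Fin r → Fin (d' + j) → ℝ,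
        ∑ i, B i ⬝ᵥ (consColumn y G i ᵥ* Q) = ∑ i, B' i 0 * y i + ∑ i, B'' i ⬝ᵥ G i := by
      intro G
      rw [← Finset.sum_add_distrib]
      refine Finset.sum_congr rfl fun i _ => ?_
      rw [dotProduct_comm, hdot, add_comm, dotProduct_comm]
    have := ih rfl B'' hB'' (fun s a => (Q *ᵥ q s) a.succ)
      (measurable_pi_lambda _ fun a => (measurable_pi_apply a.succ).comp hqQ) u' hu'
      (fun s => out s - ∑ i, B' i 0 * y i) (hout.sub measurable_const) (u (s₀, c • y))
    refine le_trans (le_of_eq ?_) this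
    congr 1
    ext G
    simp only [Set.mem_preimage, Set.mem_ofPred_eq, Function.comp_apply,
      Function.iterate_succ_apply, hfirst, htarget, hstep]
    rw [sub_sub]

/-! ### Query algorithms as state machines -/

namespace QueryAlgorithm

variable {Ω : Type*} [MeasurableSpace Ω] {n m r : ℕ}

/-- The query that `alg` makes to the compression `G` of the matrix `E * G * Eᵀ`, in a state that
consists of the number of answers so far, the seed, and the answers (those beyond the current
number are irrelevant). After `m` rounds the query is zero. -/
noncomputable def compressedQuery (alg : QueryAlgorithm Ω n m) (E : Matrix (Fin n) (Fin r) ℝ) :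
    ℕ × (Ω × (ℕ → Fin n → ℝ)) → Fin r → ℝ :=
  fun s => Eᵀ *ᵥ if h : s.1 < m then alg.query ⟨s.1, h⟩ s.2.1 (fun i => s.2.2 i) else 0

/-- The state in which `E *ᵥ y` is recorded as the next answer. -/
noncomputable def recordAnswer (Ω : Type*) (E : Matrix (Fin n) (Fin r) ℝ) :
    (ℕ × (Ω × (ℕ → Fin n → ℝ))) × (Fin r → ℝ) → ℕ × (Ω × (ℕ → Fin n → ℝ)) :=
  fun p => (p.1.1 + 1, p.1.2.1, Function.update p.1.2.2 p.1.1 (E *ᵥ p.2))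

/-- The output of `alg` as a function of the state. -/
def stateOutput (alg : QueryAlgorithm Ω n m) : ℕ × (Ω × (ℕ → Fin n → ℝ)) → ℝ :=
  fun s => alg.output s.2.1 (fun i => s.2.2 i)

lemma measurable_compressedQuery (alg : QueryAlgorithm Ω n m) (E : Matrix (Fin n) (Fin r) ℝ) :
    Measurable (alg.compressedQuery E) := by
  refine (measurable_mulVec _).comp (measurable_from_prod_countable_right fun k => ?_)
  by_cases h : k < m
  · simp only [h, dite_true]
    have : Measurable fun a : Ω × (ℕ → Fin n → ℝ) => (a.1, fun i : Fin k => a.2 i) := by fun_prop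
    exact (alg.measurable_query ⟨k, h⟩).comp this
  · simp only [h, dite_false]
    exact measurable_const

lemma measurable_recordAnswer (E : Matrix (Fin n) (Fin r) ℝ) :
    Measurable (recordAnswer Ω E) := by
  have key : ∀ k : ℕ, Measurable fun p : (Ω × (ℕ → Fin n → ℝ)) × (Fin r → ℝ) =>
      (k + 1, p.1.1, Function.update p.1.2 k (E *ᵥ p.2)) := by
    intro k
    refine measurable_const.prodMk (Measurable.prodMk (by fun_prop) ?_)
    refine measurable_pi_lambda _ fun i => ?_
    by_cases hi : i = k
    · subst hi
      simp only [Function.update_self]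
      exact (measurable_mulVec E).comp measurable_snd
    · simp only [Function.update_of_ne hi]
      fun_prop
  have h : Measurable fun p : ℕ × ((Ω × (ℕ → Fin n → ℝ)) × (Fin r → ℝ)) =>
      (p.1 + 1, p.2.1.1, Function.update p.2.1.2 p.1 (E *ᵥ p.2.2)) :=
    measurable_from_prod_countable_right key
  exact h.comp (MeasurableEquiv.prodAssoc (α := ℕ) (β := Ω × (ℕ → Fin n → ℝ))
    (γ := Fin r → ℝ)).measurable

lemma measurable_stateOutput (alg : QueryAlgorithm Ω n m) : Measurable alg.stateOutput := by
  have : Measurable fun s : ℕ × (Ω × (ℕ → Fin n → ℝ)) => (s.2.1, fun i : Fin m => s.2.2 i) := by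
    fun_prop
  exact alg.measurable_output.comp this

/-- The rounds of the state machine reproduce the answers that `alg` receives on the input
`E * G * Eᵀ`. -/
lemma iterate_queryStep_eq_answers (alg : QueryAlgorithm Ω n m) (E : Matrix (Fin n) (Fin r) ℝ)
    (G : Fin r → Fin r → ℝ) (ω : Ω) (k : ℕ) (hk : k ≤ m) :
    ∃ h : ℕ → Fin n → ℝ,
      (queryStep (alg.compressedQuery E) (recordAnswer Ω E) G)^[k] (0, ω, 0) = (k, ω, h) ∧
        (fun i : Fin k => h i) = alg.answers (E * Matrix.of G * Eᵀ) ω k hk := by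
  induction k with
  | zero => exact ⟨0, rfl, Subsingleton.elim _ _⟩
  | succ k ih =>
    obtain ⟨h, hs, ha⟩ := ih (Nat.le_of_succ_le hk)
    refine ⟨Function.update h k ((E * Matrix.of G * Eᵀ) *ᵥ
      alg.query ⟨k, hk⟩ ω (alg.answers (E * Matrix.of G * Eᵀ) ω k (Nat.le_of_succ_le hk))), ?_, ?_⟩
    · rw [Function.iterate_succ_apply', hs, ← ha]
      have hk' : k < m := hk
      simp only [queryStep, recordAnswer, compressedQuery, hk', dite_true, Prod.mk.injEq, true_and]
      rw [← Matrix.mulVec_mulVec, ← Matrix.mulVec_mulVec]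
      rfl
    · rw [answers]
      funext i
      refine Fin.lastCases ?_ (fun i => ?_) i
      · simp
      · rw [Fin.snoc_castSucc, ← ha]
        have : ((i.castSucc : Fin (k + 1)) : ℕ) ≠ k := by simpa using i.isLt.ne
        rw [Function.update_of_ne this]
        rfl

lemma run_eq_stateOutput (alg : QueryAlgorithm Ω n m) (E : Matrix (Fin n) (Fin r) ℝ)
    (G : Fin r → Fin r → ℝ) (ω : Ω) :
    alg.run (E * Matrix.of G * Eᵀ) ω = alg.stateOutput
      ((queryStep (alg.compressedQuery E) (recordAnswer Ω E) G)^[m] (0, ω, 0)) := by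
  obtain ⟨h, hs, ha⟩ := alg.iterate_queryStep_eq_answers E G ω m le_rfl
  rw [hs, run, ← ha]
  rfl

lemma measurable_run (alg : QueryAlgorithm Ω n m) (E : Matrix (Fin n) (Fin r) ℝ) :
    Measurable fun p : (Fin r → Fin r → ℝ) × Ω => alg.run (E * Matrix.of p.1 * Eᵀ) p.2 := by
  simp only [run_eq_stateOutput]
  have h₀ : Measurable fun p : (Fin r → Fin r → ℝ) × Ω =>
      (p.1, ((0, p.2, 0) : ℕ × (Ω × (ℕ → Fin n → ℝ)))) := by fun_prop
  have h₁ := (measurable_iterate_queryStep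
    (alg.measurable_compressedQuery E) (measurable_recordAnswer E) m).comp h₀
  exact alg.measurable_stateOutput.comp h₁

/-- With a fixed seed, an algorithm with `m` queries does not predict the trace of an
`r × r` Gaussian matrix better than a constant predicts a Gaussian of variance `r - m`. -/
lemma gaussianMatrix_abs_run_sub_trace_le (alg : QueryAlgorithm Ω n m)
    (E : Matrix (Fin n) (Fin r) ℝ) {x : ℝ} {β : ENNReal} {d : ℕ} (hr : r = d + m)
    (hβ : ∀ t : ℝ, gaussianReal 0 d {z | |t - z| ≤ x} ≤ β) (ω : Ω) :
    gaussianMatrix r r {G | |alg.run (E * Matrix.of G * Eᵀ) ω - ∑ i, G i i| ≤ x} ≤ β := by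
  have h := gaussianMatrix_abs_output_sub_le hβ m hr (fun i : Fin r => Pi.single i 1) (by
      ext a b
      simp [Matrix.mul_apply, Pi.single_apply, Matrix.one_apply])
    _ (alg.measurable_compressedQuery E) _ (measurable_recordAnswer E) _ alg.measurable_stateOutput
    (0, ω, 0)
  simpa only [run_eq_stateOutput, single_one_dotProduct] using h

/-- If the algorithm is accurate up to `x` with probability at least `1 - δ` on all compressed
inputs from a set `T`, then the Gaussian measure of `T` is limited by the best probability `β` of
predicting a Gaussian of variance `r - m` up to `x`. -/
lemma mul_gaussianMatrix_le (alg : QueryAlgorithm Ω n m) (μ : Measure Ω) [IsProbabilityMeasure μ]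
    (E : Matrix (Fin n) (Fin r) ℝ) {x : ℝ} {α β : ENNReal} {d : ℕ} (hr : r = d + m)
    (hβ : ∀ t : ℝ, gaussianReal 0 d {z | |t - z| ≤ x} ≤ β) {T : Set (Fin r → Fin r → ℝ)}
    (hT : MeasurableSet T)
    (h : ∀ G ∈ T, α ≤ μ {ω | |alg.run (E * Matrix.of G * Eᵀ) ω - ∑ i, G i i| ≤ x}) :
    α * gaussianMatrix r r T ≤ β := by
  let W : Set ((Fin r → Fin r → ℝ) × Ω) :=
    {p | |alg.run (E * Matrix.of p.1 * Eᵀ) p.2 - ∑ i, p.1 i i| ≤ x}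
  have hW : MeasurableSet W := measurableSet_abs_sub_le (alg.measurable_run E) (by fun_prop) x
  calc α * gaussianMatrix r r T = ∫⁻ _ in T, α ∂gaussianMatrix r r := by
        rw [setLIntegral_const]
    _ ≤ ∫⁻ G in T, μ (Prod.mk G ⁻¹' W) ∂gaussianMatrix r r := setLIntegral_mono' hT h
    _ ≤ ∫⁻ G, μ (Prod.mk G ⁻¹' W) ∂gaussianMatrix r r := setLIntegral_le_lintegral _ _
    _ = ((gaussianMatrix r r).prod μ) W := (Measure.prod_apply hW).symm
    _ = ∫⁻ ω, gaussianMatrix r r ((fun G => (G, ω)) ⁻¹' W) ∂μ := Measure.prod_apply_symm hW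
    _ ≤ ∫⁻ _, β ∂μ := lintegral_mono fun ω => alg.gaussianMatrix_abs_run_sub_trace_le E hr hβ ω
    _ = β := by simp

end QueryAlgorithm

/-! ### Gaussian estimates -/

lemma gaussianPDFReal_zero_le (v : NNReal) (z : ℝ) :
    gaussianPDFReal 0 v z ≤ (√(2 * Real.pi * v))⁻¹ := by
  rw [gaussianPDFReal]
  refine mul_le_of_le_one_right (by positivity) (Real.exp_le_one_iff.2 ?_)
  rw [neg_div]
  exact neg_nonpos.2 (by positivity)

/-- A Gaussian of variance `v` puts mass at most `x / √v` on an interval of length `2 * x`. -/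
lemma gaussianReal_abs_sub_le_div {v : NNReal} (hv : v ≠ 0) {x : ℝ} (hx : 0 ≤ x) (t : ℝ) :
    gaussianReal 0 v {z | |t - z| ≤ x} ≤ ENNReal.ofReal (x / √v) := by
  have hv' : (0 : ℝ) < v := by positivity
  have hset : {z | |t - z| ≤ x} = Set.Icc (t - x) (t + x) := by
    ext z
    rw [Set.mem_ofPred_eq, Set.mem_Icc, abs_le]
    constructor <;> rintro ⟨h1, h2⟩ <;> constructor <;> linarith
  rw [gaussianReal_apply _ hv, hset]
  calc ∫⁻ z in Set.Icc (t - x) (t + x), gaussianPDF 0 v z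
      ≤ ∫⁻ _ in Set.Icc (t - x) (t + x), ENNReal.ofReal (√(2 * Real.pi * v))⁻¹ :=
        lintegral_mono fun z => ENNReal.ofReal_le_ofReal (gaussianPDFReal_zero_le v z)
    _ = ENNReal.ofReal ((√(2 * Real.pi * v))⁻¹ * (2 * x)) := by
        rw [setLIntegral_const, Real.volume_Icc, ← ENNReal.ofReal_mul (by positivity)]
        congr 2; ring
    _ ≤ ENNReal.ofReal (x / √v) := by
        refine ENNReal.ofReal_le_ofReal ?_
        rw [Real.sqrt_mul (by positivity), mul_inv]
        have h2 : (2 : ℝ) ≤ √(2 * Real.pi) := by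
          apply Real.le_sqrt_of_sq_le; nlinarith [Real.pi_gt_three]
        have : (√(2 * Real.pi))⁻¹ ≤ 2⁻¹ := by gcongr
        calc (√(2 * Real.pi))⁻¹ * (√v)⁻¹ * (2 * x) ≤ 2⁻¹ * (√v)⁻¹ * (2 * x) := by gcongr
          _ = x / √v := by ring

lemma inv_mul_exp_le_gaussianPDFReal {v : NNReal} (hv : v ≠ 0) {x z : ℝ} (hz : |z| ≤ x + √v) :
    (√(2 * Real.pi * v))⁻¹ * Real.exp (-(x ^ 2 / v) - 1) ≤ gaussianPDFReal 0 v z := by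
  have hv' : (0 : ℝ) < v := by positivity
  rw [gaussianPDFReal, sub_zero]
  gcongr
  have h1 : z ^ 2 ≤ (x + √v) ^ 2 := sq_le_sq.2 (hz.trans (le_abs_self _))
  have h2 : (x + √v) ^ 2 ≤ 2 * (x ^ 2 + v) := by
    nlinarith [sq_nonneg (x - √v), Real.sq_sqrt hv'.le]
  rw [← sub_nonneg]
  have : -z ^ 2 / (2 * ↑v) - (-(x ^ 2 / ↑v) - 1) = (2 * (x ^ 2 + v) - z ^ 2) / (2 * v) := by
    field_simp; ring
  rw [this]
  exact div_nonneg (by linarith) (by positivity)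

lemma exp_neg_div_eight_le_gaussianReal_Ioc {v : NNReal} (hv : v ≠ 0) {x a : ℝ}
    (ha : ∀ z ∈ Set.Ioc a (a + √v), |z| ≤ x + √v) :
    ENNReal.ofReal (Real.exp (-(x ^ 2 / v)) / 8) ≤ gaussianReal 0 v (Set.Ioc a (a + √v)) := by
  have hv' : (0 : ℝ) < v := by positivity
  have hs : 0 < √(v : ℝ) := Real.sqrt_pos.2 hv'
  rw [gaussianReal_apply _ hv]
  calc ENNReal.ofReal (Real.exp (-(x ^ 2 / v)) / 8)
      ≤ ENNReal.ofReal ((√(2 * Real.pi * v))⁻¹ * Real.exp (-(x ^ 2 / v) - 1) * √v) := by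
        refine ENNReal.ofReal_le_ofReal ?_
        rw [Real.sqrt_mul (by positivity), Real.exp_sub, mul_inv]
        have h8 : √(2 * Real.pi) * Real.exp 1 ≤ 8 := by
          have h1 : √(2 * Real.pi) ≤ 2.6 := by
            apply Real.sqrt_le_iff.2 ⟨by norm_num, ?_⟩; nlinarith [Real.pi_lt_d2]
          nlinarith [Real.exp_one_lt_d9, Real.exp_pos 1]
        have e : (√(2 * Real.pi))⁻¹ * (√(v : ℝ))⁻¹ * (Real.exp (-(x ^ 2 / v)) / Real.exp 1) * √v =
            Real.exp (-(x ^ 2 / v)) / (√(2 * Real.pi) * Real.exp 1) := by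
          field_simp
        rw [e]
        gcongr
    _ = ∫⁻ _ in Set.Ioc a (a + √v),
          ENNReal.ofReal ((√(2 * Real.pi * v))⁻¹ * Real.exp (-(x ^ 2 / v) - 1)) := by
        rw [setLIntegral_const, Real.volume_Ioc, ← ENNReal.ofReal_mul (by positivity)]
        congr 2; ring
    _ ≤ ∫⁻ z in Set.Ioc a (a + √v), gaussianPDF 0 v z :=
        setLIntegral_mono' measurableSet_Ioc fun z hz =>
          ENNReal.ofReal_le_ofReal (inv_mul_exp_le_gaussianPDFReal hv (ha z hz))

/-- A Gaussian of variance `v` puts mass at least `exp (-x² / v) / 8` outside every interval of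
length `2 * x`: one of the two half-lines `(x, ∞)` and `(-∞, -x)` lies outside. -/
lemma gaussianReal_abs_sub_le_one_sub_exp {v : NNReal} (hv : v ≠ 0) {x : ℝ} (hx : 0 ≤ x) (t : ℝ) :
    gaussianReal 0 v {z | |t - z| ≤ x} ≤ ENNReal.ofReal (1 - Real.exp (-(x ^ 2 / v)) / 8) := by
  have hs : 0 ≤ √(v : ℝ) := Real.sqrt_nonneg _
  have hm : MeasurableSet {z | |t - z| ≤ x} :=
    measurableSet_le (by fun_prop) measurable_const
  have hc : ENNReal.ofReal (Real.exp (-(x ^ 2 / v)) / 8) ≤ gaussianReal 0 v {z | |t - z| ≤ x}ᶜ := by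
    rcases le_total t 0 with ht | ht
    · refine (exp_neg_div_eight_le_gaussianReal_Ioc hv (a := x) ?_).trans (measure_mono ?_)
      · rintro z ⟨h1, h2⟩
        exact abs_le.2 ⟨by linarith, by linarith⟩
      · rintro z ⟨h1, h2⟩
        simp only [Set.mem_compl_iff, Set.mem_ofPred_eq, not_le]
        exact lt_abs.2 (Or.inr (by linarith))
    · -- The half-open interval ends at `-x`, where `|t - z| > x` can fail; this is a null set.
      refine (exp_neg_div_eight_le_gaussianReal_Ioc hv (a := -x - √v) ?_).trans ?_
      · rintro z ⟨h1, h2⟩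
        exact abs_le.2 ⟨by linarith, by linarith⟩
      · have := nullSingletonClass_gaussianReal (μ := 0) hv
        rw [← measure_congr (Ioo_ae_eq_Ioc (μ := gaussianReal 0 v) (a := -x - √v))]
        refine measure_mono ?_
        rintro z ⟨h1, h2⟩
        simp only [Set.mem_compl_iff, Set.mem_ofPred_eq, not_le]
        exact lt_abs.2 (Or.inl (by linarith))
  rw [ENNReal.ofReal_sub _ (by positivity), ENNReal.ofReal_one]
  have h1 := prob_compl_eq_one_sub (μ := gaussianReal 0 v) hm.compl
  rw [compl_compl] at h1
  rw [h1]
  exact tsub_le_tsub_left hc 1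

lemma integral_exp_sq_div_four_gaussianReal :
    ∫ z, Real.exp (z ^ 2 / 4) ∂gaussianReal 0 1 = √2 := by
  rw [integral_gaussianReal_eq_integral_smul one_ne_zero]
  have h : ∀ z : ℝ, gaussianPDFReal 0 1 z • Real.exp (z ^ 2 / 4) =
      (√(2 * Real.pi))⁻¹ * Real.exp (-(1 / 4) * z ^ 2) := fun z => by
    rw [gaussianPDFReal, smul_eq_mul, mul_assoc, ← Real.exp_add]
    congr 2
    · simp
    · simp; ring
  simp_rw [h]
  rw [integral_const_mul, integral_gaussian, ← Real.sqrt_inv, ← Real.sqrt_mul (by positivity)]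
  congr 1
  field_simp
  norm_num

/-- The squared Frobenius norm of a Gaussian matrix is at least `8 * r²` with probability at most
`exp (-r²)`, by the exponential Markov inequality. -/
lemma gaussianMatrix_sum_sq_ge_le (r : ℕ) :
    (gaussianMatrix r r).real {G | 8 * (r : ℝ) ^ 2 ≤ ∑ i, ∑ j, G i j ^ 2} ≤
      Real.exp (-(r : ℝ) ^ 2) := by
  let F : (Fin r → Fin r → ℝ) → ℝ := fun G => ∏ i, ∏ j, Real.exp (G i j ^ 2 / 4)
  have hF : ∀ G, F G = Real.exp ((∑ i, ∑ j, G i j ^ 2) / 4) := fun G => by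
    simp only [F, ← Real.exp_sum, Finset.sum_div]
  have hint : ∫ G, F G ∂gaussianMatrix r r = √2 ^ (r ^ 2) := by
    simp only [F, gaussianMatrix]
    rw [integral_fintype_prod_eq_prod (f := fun _ (z : Fin r → ℝ) => ∏ j, Real.exp (z j ^ 2 / 4))]
    simp_rw [integral_fintype_prod_eq_prod (f := fun _ (z : ℝ) => Real.exp (z ^ 2 / 4)),
      integral_exp_sq_div_four_gaussianReal]
    simp [← pow_mul, sq]
  have hi : Integrable F (gaussianMatrix r r) :=
    not_imp_comm.1 integral_undef (by rw [hint]; positivity)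
  have hmar := mul_meas_ge_le_integral_of_nonneg (μ := gaussianMatrix r r) (f := F)
    (Filter.Eventually.of_forall fun G => by rw [hF]; positivity) hi (Real.exp (2 * (r : ℝ) ^ 2))
  have hset : {G | Real.exp (2 * (r : ℝ) ^ 2) ≤ F G} =
      {G | 8 * (r : ℝ) ^ 2 ≤ ∑ i, ∑ j, G i j ^ 2} := by
    ext G
    simp only [Set.mem_ofPred_eq, hF, Real.exp_le_exp]
    constructor <;> intro h <;> linarith
  rw [hset, hint] at hmar
  have h2 : √2 ^ (r ^ 2) ≤ Real.exp ((r : ℝ) ^ 2) := by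
    have : √2 ≤ Real.exp 1 := by
      refine (Real.sqrt_le_iff.2 ⟨zero_le_two, by norm_num⟩ : √2 ≤ 2).trans ?_
      linarith [Real.add_one_le_exp 1]
    calc √2 ^ (r ^ 2) ≤ Real.exp 1 ^ (r ^ 2) := by gcongr
      _ = _ := by rw [← Real.exp_nat_mul]; push_cast; rw [mul_one]
  rw [show -(r : ℝ) ^ 2 = (r : ℝ) ^ 2 - 2 * (r : ℝ) ^ 2 by ring, Real.exp_sub,
    le_div_iff₀ (Real.exp_pos _), mul_comm]
  exact hmar.trans h2

/-! ### Schatten norms and singular values -/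

/-- The squares of the singular values sum to the squared Frobenius norm. -/
lemma sum_sq_singularValues {n : ℕ} (A : Matrix (Fin n) (Fin n) ℝ) :
    ∑ i ∈ Finset.range n, (Matrix.toEuclideanLin A).singularValues i ^ 2 =
      (Aᵀ * A).trace := by
  have hn : Module.finrank ℝ (EuclideanSpace ℝ (Fin n)) = n := by simp
  set T := Matrix.toEuclideanLin A with hT
  rw [Finset.sum_range]
  simp_rw [T.sq_singularValues_fin hn]
  have h := T.isSymmetric_adjoint_comp_self.trace_eq_sum_eigenvalues hn
  simp only [RCLike.ofReal_real_eq_id, id_eq] at h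
  rw [← h, hT, ← Matrix.toEuclideanLin_conjTranspose_eq_adjoint,
    Matrix.conjTranspose_eq_transpose_of_trivial,
    LinearMap.trace_eq_matrix_trace ℝ (EuclideanSpace.basisFun (Fin n) ℝ).toBasis,
    LinearMap.toMatrix_comp _ (EuclideanSpace.basisFun (Fin n) ℝ).toBasis,
    Matrix.toEuclideanLin_eq_toLin_orthonormal,
    LinearMap.toMatrix_toLin, LinearMap.toMatrix_toLin]

lemma trace_transpose_mul_self_eq_sum {n : ℕ} (A : Matrix (Fin n) (Fin n) ℝ) :
    (Aᵀ * A).trace = ∑ i, ∑ j, A i j ^ 2 := by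
  simp only [Matrix.trace, Matrix.diag, Matrix.mul_apply, Matrix.transpose_apply, ← sq]
  rw [Finset.sum_comm]

/-- Comparison of the Schatten norm of a matrix of rank at most `k` with its Frobenius norm. -/
lemma schattenNorm_sq_le {p : ℝ} (hp1 : 1 ≤ p) (hp2 : p ≤ 2) {n k : ℕ}
    (A : Matrix (Fin n) (Fin n) ℝ) (hA : A.rank ≤ k) :
    schattenNorm p A ^ 2 ≤ (k : ℝ) ^ (2 / p - 1) * (Aᵀ * A).trace := by
  have hp : 0 < p := by linarith
  set T := Matrix.toEuclideanLin A with hT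
  have hrank : Module.finrank ℝ T.range ≤ k := by
    rwa [Matrix.rank_eq_finrank_range_toLin A (EuclideanSpace.basisFun (Fin n) ℝ).toBasis
      (EuclideanSpace.basisFun (Fin n) ℝ).toBasis,
      ← Matrix.toEuclideanLin_eq_toLin_orthonormal] at hA
  have hz : ∀ i, k ≤ i → T.singularValues i = 0 := fun i hi =>
    T.singularValues_eq_zero_iff_le_finrank_range.2 (hrank.trans hi)
  have hnz : ∀ i, n ≤ i → T.singularValues i = 0 := fun i hi =>
    T.singularValues_of_finrank_le (by simpa using hi)
  have hmono : ∀ f : ℝ → ℝ, f 0 = 0 → ∑ i ∈ Finset.range n, f (T.singularValues i) =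
      ∑ i ∈ Finset.range k, f (T.singularValues i) := by
    intro f hf
    rcases le_total n k with h | h
    · refine Finset.sum_subset (Finset.range_subset_range.2 h) fun i _ hi => ?_
      rw [hnz i (by simpa using hi), hf]
    · refine (Finset.sum_subset (Finset.range_subset_range.2 h) fun i _ hi => ?_).symm
      rw [hz i (by simpa using hi), hf]
  have hq : 1 ≤ 2 / p := by rwa [le_div_iff₀ hp, one_mul]
  have hnn : ∀ i, 0 ≤ T.singularValues i := T.singularValues_nonneg
  have h := Real.rpow_sum_le_const_mul_sum_rpow (Finset.range k)
    (fun i => T.singularValues i ^ p) hq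
  simp only [Finset.card_range, abs_of_nonneg (Real.rpow_nonneg (hnn _) p)] at h
  have e : ∀ i, (T.singularValues i ^ p) ^ (2 / p) = T.singularValues i ^ 2 := fun i => by
    rw [← Real.rpow_mul (hnn i), mul_div_cancel₀ _ hp.ne', Real.rpow_two]
  simp only [e] at h
  rw [← sum_sq_singularValues, schattenNorm, ← hT, hmono (fun y => y ^ p) (Real.zero_rpow hp.ne'),
    hmono (fun y => y ^ 2) (by simp), ← Real.rpow_natCast, ← Real.rpow_mul
      (Finset.sum_nonneg fun i _ => Real.rpow_nonneg (hnn i) p)]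
  convert! h using 2
  push_cast; ring

/-! ### Limits of trace estimation -/

/-- Without queries the output does not depend on the input, and it cannot be close to the traces
of all multiples `s • 1` of the identity, because these exceed the allowed errors by an amount
proportional to `s`. -/
lemma QueryAlgorithm.ne_zero_of_estimatesTrace {Ω : Type*} [MeasurableSpace Ω] {n m : ℕ}
    {μ : Measure Ω} [IsProbabilityMeasure μ] (alg : QueryAlgorithm Ω n m) {p ε δ : ℝ}
    (hp1 : 1 ≤ p) (hp2 : p ≤ 2) (hε : 0 < ε) (hδ : δ < 1) (hn0 : 0 < n)
    (hn : ε * (n : ℝ) ^ (1 / p) < n) (h : alg.EstimatesTrace μ p ε δ) : m ≠ 0 := by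
  rintro rfl
  have hnR : (0 : ℝ) < n := by exact_mod_cast hn0
  let t : Ω → ℝ := fun ω => alg.output ω Fin.elim0
  have ht : Measurable t := alg.measurable_output.comp (measurable_id.prodMk measurable_const)
  have hκ : 0 < n - ε * (n : ℝ) ^ (1 / p) := sub_pos.2 hn
  set κ := n - ε * (n : ℝ) ^ (1 / p) with hκdef
  let U : ℕ → Set Ω := fun s => {ω | s * κ ≤ t ω}
  have hU : ∀ s, 1 - δ ≤ μ.real (U s) := by
    intro s
    refine (h ((s : ℝ) • 1)).trans (measureReal_mono ?_)
    have hsch : schattenNorm p ((s : ℝ) • (1 : Matrix (Fin n) (Fin n) ℝ)) ≤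
        s * (n : ℝ) ^ (1 / p) := by
      refine le_of_sq_le_sq ?_ (by positivity)
      refine (schattenNorm_sq_le hp1 hp2 _ (Matrix.rank_le_height _)).trans (le_of_eq ?_)
      have e : (n : ℝ) ^ (2 / p - 1) * n = ((n : ℝ) ^ (1 / p)) ^ 2 := by
        rw [← Real.rpow_add_one hnR.ne', ← Real.rpow_natCast, ← Real.rpow_mul hnR.le]
        congr 1; push_cast; ring
      rw [mul_pow, ← e]
      simp
      ring
    intro ω hω
    have hω' : |t ω - s * n| ≤ ε * schattenNorm p ((s : ℝ) • (1 : Matrix (Fin n) (Fin n) ℝ)) := by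
      have e : ((s : ℝ) • (1 : Matrix (Fin n) (Fin n) ℝ)).trace = s * n := by simp
      rw [← e]
      exact hω
    have h2 := (abs_le.1 (hω'.trans (mul_le_mul_of_nonneg_left hsch hε.le))).1
    change s * κ ≤ t ω
    rw [hκdef]
    nlinarith
  have hanti : Antitone U := fun a b hab ω (hω : b * κ ≤ t ω) =>
    (mul_le_mul_of_nonneg_right (by exact_mod_cast hab) hκ.le).trans hω
  have hempty : ⋂ s, U s = ∅ := by
    refine Set.eq_empty_of_forall_notMem fun ω hω => ?_
    obtain ⟨s, hs⟩ := exists_nat_gt (t ω / κ)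
    have h1 : s * κ ≤ t ω := Set.mem_iInter.1 hω s
    rw [div_lt_iff₀ hκ] at hs
    linarith
  have hlim := tendsto_measure_iInter_atTop (μ := μ) (s := U)
    (fun s => (measurableSet_le measurable_const ht).nullMeasurableSet) hanti
    ⟨0, measure_ne_top _ _⟩
  rw [hempty, measure_empty] at hlim
  have hlim' := (ENNReal.tendsto_toReal ENNReal.zero_ne_top).comp hlim
  have := ge_of_tendsto' hlim' hU
  simp at this
  linarith

/-- There is an isometric embedding of `ℝ^r` into `ℝ^n`. -/
lemma exists_transpose_mul_self_eq_one {r n : ℕ} (h : r ≤ n) :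
    ∃ E : Matrix (Fin n) (Fin r) ℝ, Eᵀ * E = 1 := by
  refine ⟨(1 : Matrix (Fin n) (Fin n) ℝ).submatrix id (Fin.castLE h), ?_⟩
  ext a b
  simp [Matrix.mul_apply, Matrix.one_apply]

/-- The trade-off behind the lower bound. The allowed error `ε * ‖A‖_p` is at most `x` on the
matrices `A = E * G * Eᵀ`, where `Eᵀ * E = 1` and `G` lies in the Frobenius ball of squared radius
`8 * r²`. That ball has Gaussian measure at least `1 - exp (-r²)`, so this number times the success
probability is at most the probability `β` of predicting a Gaussian of variance `r - m` up to `x`.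
-/
lemma QueryAlgorithm.one_sub_mul_le {Ω : Type*} [MeasurableSpace Ω] {n m : ℕ}
    {μ : Measure Ω} [IsProbabilityMeasure μ] (alg : QueryAlgorithm Ω n m) {p ε δ : ℝ}
    (hp1 : 1 ≤ p) (hp2 : p ≤ 2) (hδ : δ ≤ 1) (h : alg.EstimatesTrace μ p ε δ)
    {r d : ℕ} (hr : r = d + m) (hr0 : 0 < r) (hrn : r ≤ n) {x β : ℝ} (hx : 0 ≤ x) (hβ0 : 0 ≤ β)
    (hβ : ∀ t : ℝ, gaussianReal 0 d {z | |t - z| ≤ x} ≤ ENNReal.ofReal β)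
    (hxr : 8 * ε ^ 2 * ((r : ℝ) ^ (1 / p)) ^ 2 * r ≤ x ^ 2) :
    (1 - δ) * (1 - Real.exp (-(r : ℝ) ^ 2)) ≤ β := by
  obtain ⟨E, hE⟩ := exists_transpose_mul_self_eq_one hrn
  have hrR : (0 : ℝ) < r := by exact_mod_cast hr0
  let T : Set (Fin r → Fin r → ℝ) := {G | 8 * (r : ℝ) ^ 2 ≤ ∑ i, ∑ j, G i j ^ 2}
  have hT : MeasurableSet T := measurableSet_le measurable_const (by fun_prop)
  have hEstep : ∀ G ∈ Tᶜ, ENNReal.ofReal (1 - δ) ≤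
      μ {ω | |alg.run (E * Matrix.of G * Eᵀ) ω - ∑ i, G i i| ≤ x} := by
    intro G hG
    have hG' : ∑ i, ∑ j, G i j ^ 2 ≤ 8 * (r : ℝ) ^ 2 := (not_le.1 (Set.notMem_ofPred_iff.1 hG)).le
    have htr : (E * Matrix.of G * Eᵀ).trace = ∑ i, G i i := by
      rw [Matrix.trace_mul_comm, ← Matrix.mul_assoc, hE, Matrix.one_mul]
      rfl
    have hfr : ((E * Matrix.of G * Eᵀ)ᵀ * (E * Matrix.of G * Eᵀ)).trace =
        ∑ i, ∑ j, G i j ^ 2 := by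
      have e : (E * Matrix.of G * Eᵀ)ᵀ * (E * Matrix.of G * Eᵀ) =
          E * ((Matrix.of G)ᵀ * (Eᵀ * E) * Matrix.of G * Eᵀ) := by
        simp only [Matrix.transpose_mul, Matrix.transpose_transpose, Matrix.mul_assoc]
      rw [e, hE, Matrix.trace_mul_comm, Matrix.mul_one, Matrix.mul_assoc, Matrix.mul_assoc, hE,
        Matrix.mul_one, trace_transpose_mul_self_eq_sum]
      rfl
    have hsch : ε * schattenNorm p (E * Matrix.of G * Eᵀ) ≤ x := by
      refine le_of_sq_le_sq (le_trans ?_ hxr) hx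
      have h1 := schattenNorm_sq_le hp1 hp2 (E * Matrix.of G * Eᵀ) (k := r)
        ((Matrix.rank_mul_le_right _ _).trans (Matrix.rank_le_height _))
      rw [hfr] at h1
      have e : (r : ℝ) ^ (2 / p - 1) * (8 * (r : ℝ) ^ 2) = 8 * ((r : ℝ) ^ (1 / p)) ^ 2 * r := by
        have : (r : ℝ) ^ (2 / p - 1) * r = ((r : ℝ) ^ (1 / p)) ^ 2 := by
          rw [← Real.rpow_add_one hrR.ne', ← Real.rpow_natCast, ← Real.rpow_mul hrR.le]
          congr 1; push_cast; ring
        rw [← this]; ring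
      calc (ε * schattenNorm p (E * Matrix.of G * Eᵀ)) ^ 2
          = ε ^ 2 * schattenNorm p (E * Matrix.of G * Eᵀ) ^ 2 := by ring
        _ ≤ ε ^ 2 * ((r : ℝ) ^ (2 / p - 1) * (8 * (r : ℝ) ^ 2)) := by
            refine mul_le_mul_of_nonneg_left (h1.trans ?_) (sq_nonneg _)
            gcongr
        _ = _ := by rw [e]; ring
    refine ENNReal.ofReal_le_of_le_toReal ((h (E * Matrix.of G * Eᵀ)).trans ?_)
    refine measureReal_mono fun ω hω => ?_
    simp only [Set.mem_ofPred_eq, htr] at hω ⊢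
    exact hω.trans hsch
  have hmain := alg.mul_gaussianMatrix_le μ E hr hβ hT.compl hEstep
  have hball : ENNReal.ofReal (1 - Real.exp (-(r : ℝ) ^ 2)) ≤ gaussianMatrix r r Tᶜ := by
    refine ENNReal.ofReal_le_of_le_toReal ?_
    change _ ≤ (gaussianMatrix r r).real Tᶜ
    rw [probReal_compl_eq_one_sub hT]
    linarith [gaussianMatrix_sum_sq_ge_le r]
  have := (mul_le_mul_right hball (ENNReal.ofReal (1 - δ))).trans hmain
  rw [← ENNReal.ofReal_mul (by linarith)] at this
  exact (ENNReal.ofReal_le_ofReal_iff hβ0).1 this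

/-! ### Choice of the constants -/

/-- No constant predicts a Gaussian up to `c * √L` standard deviations with probability
`(1 - exp (-L)) * (1 - exp (-N))`, where `N ≥ L`. The constant `c` only depends on a lower bound for
`L`; the length of the interval decides the case `L ≤ 4`, the tails of the Gaussian the case
`4 ≤ L`. -/
lemma exists_gaussianReal_abs_sub_le {L₀ : ℝ} (hL₀ : 0 < L₀) :
    ∃ c : ℝ, 0 < c ∧ c ≤ 1 ∧ ∀ (L N : ℝ) (v : NNReal), L₀ ≤ L → 1 ≤ N → L ≤ N → v ≠ 0 →
      ∃ β : ℝ, 0 ≤ β ∧ (∀ t : ℝ, gaussianReal 0 v {z | |t - z| ≤ c * √(L * v)} ≤ ENNReal.ofReal β) ∧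
        β < (1 - Real.exp (-L)) * (1 - Real.exp (-N)) := by
  have hE : Real.exp (-L₀) < 1 := Real.exp_lt_one_iff.2 (by linarith)
  set κ := 1 - Real.exp (-L₀) with hκ
  have hκ0 : 0 < κ := sub_pos.2 hE
  have hκ1 : κ < 1 := by linarith [Real.exp_pos (-L₀)]
  refine ⟨κ / 4, by positivity, by linarith, fun L N v hL hN hLN hv => ?_⟩
  have hL0 : 0 < L := hL₀.trans_le hL
  have hvR : (0 : ℝ) < v := by positivity
  have hx : 0 ≤ κ / 4 * √(L * v) := by positivity
  rcases le_total L 4 with h4 | h4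
  · refine ⟨κ / 4 * √(L * v) / √v, by positivity, gaussianReal_abs_sub_le_div hv hx, ?_⟩
    have e : κ / 4 * √(L * v) / √v = κ / 4 * √L := by
      rw [Real.sqrt_mul hL0.le]
      field_simp
    have hs : √L ≤ 2 := Real.sqrt_le_iff.2 ⟨by norm_num, by linarith⟩
    have h1 : κ ≤ 1 - Real.exp (-L) := by
      have : Real.exp (-L) ≤ Real.exp (-L₀) := Real.exp_le_exp.2 (by linarith)
      linarith
    have h2 : 0.6 < 1 - Real.exp (-N) := by
      have : Real.exp (-N) ≤ Real.exp (-1) := Real.exp_le_exp.2 (by linarith)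
      linarith [Real.exp_neg_one_lt_d9]
    rw [e]
    nlinarith
  · refine ⟨1 - Real.exp (-((κ / 4 * √(L * v)) ^ 2 / v)) / 8, ?_,
      gaussianReal_abs_sub_le_one_sub_exp hv hx, ?_⟩
    · have : Real.exp (-((κ / 4 * √(L * v)) ^ 2 / v)) ≤ 1 :=
        Real.exp_le_one_iff.2 (neg_nonpos.2 (by positivity))
      linarith
    have e : (κ / 4 * √(L * v)) ^ 2 / v = (κ / 4) ^ 2 * L := by
      rw [mul_pow, Real.sq_sqrt (by positivity)]
      field_simp
    have h1 : Real.exp (-(L / 4)) ≤ Real.exp (-((κ / 4) ^ 2 * L)) := by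
      apply Real.exp_le_exp.2
      have : (κ / 4) ^ 2 ≤ 1 / 4 := by nlinarith
      nlinarith
    have h2 : Real.exp (-N) ≤ Real.exp (-L) := Real.exp_le_exp.2 (by linarith)
    have h3 : Real.exp (-L) * 16 < Real.exp (-(L / 4)) := by
      have e3 : (16 : ℝ) < Real.exp 3 := by
        have : Real.exp 3 = Real.exp 1 ^ 3 := by rw [← Real.exp_nat_mul]; norm_num
        rw [this]
        calc (16 : ℝ) < 2.7 ^ 3 := by norm_num
          _ ≤ _ := by gcongr; linarith [Real.exp_one_gt_d9]
      have e4 : Real.exp 3 ≤ Real.exp (3 * L / 4) := Real.exp_le_exp.2 (by linarith)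
      have e5 : Real.exp (-(L / 4)) = Real.exp (-L) * Real.exp (3 * L / 4) := by
        rw [← Real.exp_add]; congr 1; ring
      rw [e5]
      exact mul_lt_mul_of_pos_left (e3.trans_le e4) (Real.exp_pos _)
    rw [e]
    have := mul_pos (Real.exp_pos (-L)) (Real.exp_pos (-N))
    nlinarith

/-- For large `n` the bound `ε * ‖1‖_p` on the error at the identity matrix is below its trace. -/
lemma exists_forall_mul_rpow_one_div_lt {p ε : ℝ} (hp1 : 1 ≤ p) (hε : p = 1 → ε < 1) :
    ∃ n₀ : ℕ, ∀ n : ℕ, n₀ ≤ n → 0 < n ∧ ε * (n : ℝ) ^ (1 / p) < n := by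
  rcases hp1.eq_or_lt with rfl | hp
  · refine ⟨1, fun n hn => ⟨hn, ?_⟩⟩
    have : (0 : ℝ) < n := by exact_mod_cast hn
    rw [div_one, Real.rpow_one]
    nlinarith [hε rfl]
  · have hq : 0 < 1 - 1 / p := by
      rw [sub_pos, div_lt_one (by linarith)]; exact hp
    have h := ((tendsto_rpow_atTop hq).comp tendsto_natCast_atTop_atTop).eventually_gt_atTop ε
    obtain ⟨n₀, hn₀⟩ := Filter.eventually_atTop.1 (h.and (Filter.eventually_gt_atTop 0))
    refine ⟨n₀, fun n hn => ?_⟩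
    obtain ⟨h1, h2⟩ := hn₀ n hn
    have hnR : (0 : ℝ) < n := by exact_mod_cast h2
    refine ⟨h2, ?_⟩
    calc ε * (n : ℝ) ^ (1 / p) < (n : ℝ) ^ (1 - 1 / p) * (n : ℝ) ^ (1 / p) :=
          mul_lt_mul_of_pos_right h1 (by positivity)
      _ = n := by rw [← Real.rpow_add hnR]; simp

theorem theorem4p2 (δ₀ : ℝ) (hδ₀ : δ₀ < 1) :
    ∃ c : ℝ, 0 < c ∧
      ∀ p δ ε : ℝ, 1 ≤ p → p ≤ 2 → 0 < δ → δ ≤ δ₀ →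
        0 < ε → ε < (Real.log (1 / δ)) ^ (1 / 2 - 1 / p) → (p = 1 → ε < 1) →
        ∃ n₀ : ℕ, ∀ n : ℕ, n₀ ≤ n →
          ∀ (m : ℕ) (Ω : Type*) [MeasurableSpace Ω] (μ : MeasureTheory.Measure Ω)
            [MeasureTheory.IsProbabilityMeasure μ] (alg : QueryAlgorithm Ω n m),
            alg.EstimatesTrace μ p ε δ →
              c * (Real.sqrt (Real.log (1 / δ)) / ε) ^ p ≤ (m : ℝ) := by
  rcases le_or_gt δ₀ 0 with hneg | hpos
  · exact ⟨1, one_pos, fun p δ ε _ _ h1 h2 => absurd (h1.trans_le (h2.trans hneg)) (lt_irrefl 0)⟩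
  have hL₀ : 0 < Real.log (1 / δ₀) := Real.log_pos (by rwa [lt_div_iff₀ hpos, one_mul])
  obtain ⟨b, hb0, hb1, hb⟩ := exists_gaussianReal_abs_sub_le hL₀
  set a := (b / 4) ^ 2 with ha
  have ha0 : 0 < a := by positivity
  have ha1 : a ≤ 1 := by rw [ha]; nlinarith
  refine ⟨a ^ 2 / 4, by positivity, fun p δ ε hp1 hp2 hδ hδ' hε hεL hε1 => ?_⟩
  have hp : 0 < p := by linarith
  set L := Real.log (1 / δ) with hL
  have hL₀L : Real.log (1 / δ₀) ≤ L :=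
    Real.log_le_log (by positivity) (one_div_le_one_div_of_le hδ hδ')
  have hL0 : 0 < L := hL₀.trans_le hL₀L
  have hδL : δ = Real.exp (-L) := by
    rw [hL, one_div, Real.log_inv, neg_neg, Real.exp_log hδ]
  set k := (√L / ε) ^ p with hk
  have hk0 : 0 < k := by positivity
  -- The condition on `ε` says exactly that the claimed number of queries exceeds `log (1 / δ)`.
  have hLk : L ≤ k := by
    have h1 : L ^ (1 / p) ≤ √L / ε := by
      rw [le_div_iff₀ hε]
      calc L ^ (1 / p) * ε ≤ L ^ (1 / p) * L ^ (1 / 2 - 1 / p) := by gcongr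
        _ = √L := by rw [← Real.rpow_add hL0, Real.sqrt_eq_rpow]; congr 1; ring
    calc L = (L ^ (1 / p)) ^ p := by
          rw [← Real.rpow_mul hL0.le, one_div_mul_cancel hp.ne', Real.rpow_one]
      _ ≤ k := Real.rpow_le_rpow (by positivity) h1 hp.le
  set r := ⌊a * k⌋₊ with hr
  have hrle : (r : ℝ) ≤ a * k := Nat.floor_le (by positivity)
  obtain ⟨n₁, hn₁⟩ := exists_forall_mul_rpow_one_div_lt hp1 hε1
  refine ⟨max n₁ r, fun n hn m Ω _ μ _ alg halg => ?_⟩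
  obtain ⟨hn0, hnε⟩ := hn₁ n ((le_max_left _ _).trans hn)
  have hm : 1 ≤ m := Nat.one_le_iff_ne_zero.2
    (alg.ne_zero_of_estimatesTrace hp1 hp2 hε (hδ'.trans_lt hδ₀) hn0 hnε halg)
  have hmR : (1 : ℝ) ≤ m := by exact_mod_cast hm
  rcases le_total (a ^ 2 / 4 * k) 1 with hsmall | hlarge
  · exact hsmall.trans hmR
  by_contra! hlt
  have hrge : a * k / 2 ≤ r := by
    have := Nat.lt_floor_add_one (a * k)
    rw [← hr] at this
    nlinarith
  have hmr : (2 * m : ℝ) ≤ r := by nlinarith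
  have hmr' : 2 * m ≤ r := by exact_mod_cast hmr
  have hr0 : 0 < r := by omega
  have hrR : (1 : ℝ) ≤ r := by exact_mod_cast hr0
  obtain ⟨d, hd⟩ := Nat.exists_eq_add_of_le' (show m ≤ r by omega)
  have hdr : (r : ℝ) / 2 ≤ d := by
    have : (r : ℝ) = d + m := by exact_mod_cast hd
    linarith
  have hLr : L ≤ (r : ℝ) ^ 2 := by
    have h1 : (a * k / 2) ^ 2 ≤ (r : ℝ) ^ 2 := by gcongr
    nlinarith
  have hd0 : (d : NNReal) ≠ 0 := by
    have : d ≠ 0 := by omega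
    exact_mod_cast this
  obtain ⟨β, hβ0, hβ, hβlt⟩ := hb L ((r : ℝ) ^ 2) d hL₀L (by nlinarith) hLr hd0
  -- `r` is chosen so small that the allowed error is below the scale of the trace's fluctuation.
  have hrp : ε * (r : ℝ) ^ (1 / p) ≤ b / 4 * √L := by
    have h1 : (r : ℝ) ≤ (b / 4 * (√L / ε)) ^ p := by
      rw [Real.mul_rpow (by positivity) (by positivity)]
      refine hrle.trans (mul_le_mul_of_nonneg_right ?_ hk0.le)
      rw [ha, ← Real.rpow_two]
      exact Real.rpow_le_rpow_of_exponent_ge (by positivity) (by linarith) hp2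
    have h2 : (r : ℝ) ^ (1 / p) ≤ b / 4 * (√L / ε) := by
      refine (Real.rpow_le_rpow (by positivity) h1 (by positivity)).trans (le_of_eq ?_)
      rw [← Real.rpow_mul (by positivity), mul_one_div_cancel hp.ne', Real.rpow_one]
    calc ε * (r : ℝ) ^ (1 / p) ≤ ε * (b / 4 * (√L / ε)) := by gcongr
      _ = b / 4 * √L := by field_simp
  have hxr : 8 * ε ^ 2 * ((r : ℝ) ^ (1 / p)) ^ 2 * r ≤ (b * √(L * (d : NNReal))) ^ 2 := by
    have h1 : (ε * (r : ℝ) ^ (1 / p)) ^ 2 ≤ (b / 4 * √L) ^ 2 := by gcongr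
    rw [mul_pow, mul_pow, Real.sq_sqrt hL0.le] at h1
    rw [mul_pow, Real.sq_sqrt (by positivity)]
    push_cast
    calc 8 * ε ^ 2 * ((r : ℝ) ^ (1 / p)) ^ 2 * r
        = 8 * (ε ^ 2 * ((r : ℝ) ^ (1 / p)) ^ 2) * r := by ring
      _ ≤ 8 * ((b / 4) ^ 2 * L) * r := by gcongr
      _ = b ^ 2 * (L * (r / 2)) := by ring
      _ ≤ b ^ 2 * (L * d) := by gcongr
  have := alg.one_sub_mul_le hp1 hp2 (hδ'.trans hδ₀.le) halg hd hr0 ((le_max_right _ _).trans hn)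
    (by positivity) hβ0 hβ hxr
  rw [hδL] at this
  linarith
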